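/- Let $\mathscr H$ be a complex Hilbert space and let $|||\cdot|||$ be a unitarily invariant norm, that is, a norm on a two-sided ideal $\mathfrak J$ of $\mathbb B(\mathscr H)$ such that $|||UXV|||=|||X|||$ for all $X\in\mathfrak J$ and all unitaries $U,V\in\mathbb B(\mathscr H)$. Let $A,B\in\mathbb B(\mathscr H)$ be positive (semidefinite) operators and let $X\in\mathfrak J$. For $\nu\in[0,1]$ put $$F(\nu)=|||A^{\nu}XB^{1-\nu}+A^{1-\nu}XB^{\nu}|||,$$ where powers are taken in the continuous functional calculus and $A^0=B^0=I$. Let $\alpha,\beta\in[0,1]$. Then $F$ is integrable between $\alpha$ and $\beta$, and for every $\lambda\in[0,1]$ $$F\left(\frac{\alpha+\beta}{2}\right)\le l(\lambda)\le \frac{1}{\beta-\alpha}\int_\alpha^\beta F(x)\,dx\le L(\lambda)\le\frac{F(\alpha)+F(\beta)}{2},$$ where $$l(\lambda)=\lambda F\left(\frac{\lambda\beta+(2-\lambda)\alpha}{2}\right)+(1-\lambda)F\left(\frac{(1+\lambda)\beta+(1-\lambda)\alpha}{2}\right),$$ $$L(\lambda)=\frac12\bigl(F(\lambda\beta+(1-\lambda)\alpha)+\lambda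 F(\alpha)+(1-\lambda)F(\beta)\bigr),$$ and where the mean $\frac{1}{\beta-\alpha}\int_\alpha^\beta F(x)\,dx$ is read as $F(\alpha)$ if $\alpha=\beta$. -/

import Mathlib

noncomputable section

/-- A unitarily invariant norm on `𝔹(H)`: a two-sided ideal of `𝔹(H)` together with a norm on that
ideal that satisfies `|||U X V||| = |||X|||` for all unitaries `U`, `V`. (Neither completeness of
the ideal nor a normalization on rank-one operators is required.) -/
structure UnitarilyInvariantNorm (H : Type*) [NormedAddCommGroup H] [InnerProductSpace ℂ H]
    [CompleteSpace H] where
  ideal : Submodule ℂ (H →L[ℂ] H)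
  mul_mem_left : ∀ (T : H →L[ℂ] H) {X : H →L[ℂ] H}, X ∈ ideal → T * X ∈ ideal
  mul_mem_right : ∀ {X : H →L[ℂ] H} (T : H →L[ℂ] H), X ∈ ideal → X * T ∈ ideal
  norm : ideal → ℝ
  norm_add_le : ∀ X Y : ideal, norm (X + Y) ≤ norm X + norm Y
  norm_smul : ∀ (c : ℂ) (X : ideal), norm (c • X) = ‖c‖ * norm X
  eq_zero_of_norm_eq_zero : ∀ X : ideal, norm X = 0 → X = 0
  norm_unitary_mul_mul : ∀ U ∈ unitary (H →L[ℂ] H), ∀ V ∈ unitary (H →L[ℂ] H), ∀ X : ideal,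
    norm ⟨U * X * V, mul_mem_right V (mul_mem_left U X.2)⟩ = norm X

/-- `A ^ ν X B ^ (1 - ν) + A ^ (1 - ν) X B ^ ν`. The powers of positive operators are those of the
continuous functional calculus, with `A ^ 0 = 1`. -/
def heinzOp {H : Type*} [NormedAddCommGroup H] [InnerProductSpace ℂ H] [CompleteSpace H]
    (A B X : H →L[ℂ] H) (ν : ℝ) : H →L[ℂ] H :=
  A ^ ν * X * B ^ (1 - ν) + A ^ (1 - ν) * X * B ^ ν

theorem heinzOp_mem {H : Type*} [NormedAddCommGroup H] [InnerProductSpace ℂ H] [CompleteSpace H]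
    (N : UnitarilyInvariantNorm H) (A B : H →L[ℂ] H) (X : N.ideal) (ν : ℝ) :
    heinzOp A B X ν ∈ N.ideal :=
  N.ideal.add_mem (N.mul_mem_right _ (N.mul_mem_left _ X.2))
    (N.mul_mem_right _ (N.mul_mem_left _ X.2))

/-- `F(ν) = |||A ^ ν X B ^ (1 - ν) + A ^ (1 - ν) X B ^ ν|||`. -/
def heinzNorm {H : Type*} [NormedAddCommGroup H] [InnerProductSpace ℂ H] [CompleteSpace H]
    (N : UnitarilyInvariantNorm H) (A B : H →L[ℂ] H) (X : N.ideal) (ν : ℝ) : ℝ :=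
  N.norm ⟨heinzOp A B X ν, heinzOp_mem N A B X ν⟩

/-- The integral mean of `f` between `a` and `b` (in either order); it is `f a` on the degenerate
interval `a = b`. -/
def integralMean (f : ℝ → ℝ) (a b : ℝ) : ℝ :=
  if a = b then f a else 1 / (b - a) * ∫ x in a..b, f x

/-- El Farissi's lower expression `l(lam)`. -/
def farissiLower (f : ℝ → ℝ) (a b lam : ℝ) : ℝ :=
  lam * f ((lam * b + (2 - lam) * a) / 2) + (1 - lam) * f (((1 + lam) * b + (1 - lam) * a) / 2)

/-- El Farissi's upper expression `L(lam)`. -/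
def farissiUpper (f : ℝ → ℝ) (a b lam : ℝ) : ℝ :=
  1 / 2 * (f (lam * b + (1 - lam) * a) + lam * f a + (1 - lam) * f b)

end

/-! ### One-parameter groups that are isometric on the imaginary axis -/

section OneParameterGroup

open Polynomial Filter Topology

/-! The inequalities hold for every convex function, so the point is that `F` is convex on [0,1].
Midpoint convexity is the arithmetic-geometric mean inequality 2|||CYD||| ≤ |||C²Y + YD²||| with C,
D powers of A, B. For invertible C, D it compares Z = CYD with g(1)Z + g(-1)Z, where g(z)Z = C^z Z
D^(-z). On the imaginary axis g acts by unitaries, so it is isometric, and the inequality is an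
operator form of 1 ≤ cosh: the generator a behaves as if its spectrum were real.

That form is proved without completeness of the ideal. Euler's formula approximates g(1) + g(-1) by
p(a), where p has only imaginary roots and p(0) = 2. Isometry gives ‖(a - r)x‖ ≥ |r|‖x‖ for
imaginary r, and multiplying over the roots gives ‖p(a)x‖ ≥ 2‖x‖.

Since `F` may jump at 0 and 1, where A^0 = I, convexity up to the end points comes from midpoint
convexity and boundedness. El Farissi's chain is Hermite-Hadamard on the two pieces into which `lam`
cuts the interval. -/

theorem norm_pow_sub_pow_le_of_norm_le {R : Type*} [SeminormedRing R] {u v : R} {r : ℝ} (hr : 1 ≤ r)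
    (hu : ‖u‖ ≤ r) (hv : ‖v‖ ≤ r) (h1 : ‖(1 : R)‖ ≤ 1) (n : ℕ) :
    ‖u ^ n - v ^ n‖ ≤ n * r ^ n * ‖u - v‖ := by
  have hr0 : 0 ≤ r := by linarith
  have hpow : ∀ k : ℕ, ‖v ^ k‖ ≤ r ^ k := by
    intro k
    induction k with
    | zero => simpa using h1
    | succ k ih =>
      rw [pow_succ, pow_succ]
      exact (norm_mul_le _ _).trans (by gcongr)
  induction n with
  | zero => simp
  | succ n ih =>
    have e : u ^ (n + 1) - v ^ (n + 1) = u * (u ^ n - v ^ n) + (u - v) * v ^ n := by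
      rw [pow_succ', pow_succ']; noncomm_ring
    rw [e]
    calc ‖u * (u ^ n - v ^ n) + (u - v) * v ^ n‖
        ≤ ‖u‖ * ‖u ^ n - v ^ n‖ + ‖u - v‖ * ‖v ^ n‖ :=
          (norm_add_le _ _).trans (add_le_add (norm_mul_le _ _) (norm_mul_le _ _))
      _ ≤ r * (n * r ^ n * ‖u - v‖) + ‖u - v‖ * (r * r ^ n) := by
          have := hpow n
          have h2 : r ^ n ≤ r * r ^ n := le_mul_of_one_le_left (by positivity) hr
          gcongr
          exact this.trans h2
      _ = _ := by push_cast; ring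

/-- Euler's formula `(1 + z a / n) ^ n → g z` for a one-parameter group `g` with generator `a` in a
normed ring, which need not be complete. -/
theorem tendsto_one_add_smul_pow_of_hasDerivAt {R : Type*} [NormedRing R] [NormedAlgebra ℂ R]
    {g : ℂ → R} {a : R} (h1 : ‖(1 : R)‖ ≤ 1) (h0 : g 0 = 1) (hadd : ∀ z w, g (z + w) = g z * g w)
    (hd : HasDerivAt g a 0) (z : ℂ) :
    Tendsto (fun n : ℕ => (1 + (z / n) • a) ^ n) atTop (𝓝 (g z)) := by
  have hpow : ∀ (n : ℕ) (w : ℂ), g (n * w) = g w ^ n := by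
    intro n w
    induction n with
    | zero => simp [h0]
    | succ n ih => rw [pow_succ, ← ih, ← hadd]; congr 1; push_cast; ring
  have ho := hd.isLittleO
  simp only [h0, sub_zero] at ho
  have hz : Tendsto (fun n : ℕ => z / n) atTop (𝓝 (0 : ℂ)) := tendsto_const_div_atTop_nhds_zero_nat z
  have ho' := ho.comp_tendsto hz
  rw [tendsto_iff_norm_sub_tendsto_zero, Metric.tendsto_atTop]
  intro ε hε
  set c : ℝ := ‖z‖ * ‖a‖ with hc
  have hc0 : 0 ≤ c := by positivity
  -- The bound 1 keeps ‖u‖ below exp((c+1)/n); the other bound makes the final error ε/2.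
  set δ : ℝ := min 1 (ε / (2 * Real.exp (c + 1))) / (‖z‖ + 1) with hδ
  have hm0 : 0 < min 1 (ε / (2 * Real.exp (c + 1))) := lt_min one_pos (by positivity)
  have hδ0 : 0 < δ := by positivity
  obtain ⟨n₀, hn₀⟩ := eventually_atTop.1 (ho'.def hδ0)
  refine ⟨n₀ + 1, fun n hn => ?_⟩
  have hnpos : (0 : ℝ) < n := by exact_mod_cast (by omega : 0 < n)
  have hb := hn₀ n (by omega)
  simp only [Function.comp] at hb
  set u := g (z / n) with hu
  set v := 1 + (z / n) • a with hv
  have hb' : ‖u - v‖ ≤ min 1 (ε / (2 * Real.exp (c + 1))) / n := by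
    rw [sub_sub] at hb
    refine hb.trans ?_
    rw [norm_div, Complex.norm_natCast, hδ, div_mul_div_comm, div_le_div_iff₀ (by positivity) hnpos]
    have : ‖z‖ ≤ ‖z‖ + 1 := by linarith
    nlinarith [mul_le_mul_of_nonneg_left this (mul_nonneg hm0.le hnpos.le)]
  have hv1 : ‖v‖ ≤ 1 + c / n := by
    refine (norm_add_le _ _).trans (add_le_add h1 ?_)
    refine (norm_smul_le _ _).trans_eq ?_
    rw [norm_div, Complex.norm_natCast, hc]; ring
  have hexp : 1 + (c + 1) / n ≤ Real.exp ((c + 1) / n) := by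
    linarith [Real.add_one_le_exp ((c + 1) / n)]
  have hcn : c / n + 1 / n = (c + 1) / n := by ring
  have hn1 : 0 < 1 / (n : ℝ) := by positivity
  have hv2 : ‖v‖ ≤ Real.exp ((c + 1) / n) := by linarith
  have hu2 : ‖u‖ ≤ Real.exp ((c + 1) / n) := by
    have h3 : ‖u - v‖ ≤ 1 / n := hb'.trans (by gcongr; exact min_le_left _ _)
    have h4 : ‖u‖ ≤ ‖v‖ + ‖u - v‖ := by simpa using norm_add_le v (u - v)
    linarith
  have hr : 1 ≤ Real.exp ((c + 1) / n) := Real.one_le_exp (by positivity)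
  have key := norm_pow_sub_pow_le_of_norm_le hr hu2 hv2 h1 n
  have hgu : u ^ n = g z := by
    rw [hu, ← hpow]; congr 1
    have : (n : ℂ) ≠ 0 := by exact_mod_cast hnpos.ne'
    field_simp
  have hrn : Real.exp ((c + 1) / n) ^ n = Real.exp (c + 1) := by
    rw [← Real.exp_nat_mul]; congr 1; field_simp
  rw [hgu, hrn, norm_sub_rev] at key
  rw [dist_zero_right, norm_norm]
  have h5 : ‖u - v‖ ≤ ε / (2 * Real.exp (c + 1)) / n := hb'.trans (by gcongr; exact min_le_right _ _)
  calc _ ≤ _ := key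
    _ ≤ n * Real.exp (c + 1) * (ε / (2 * Real.exp (c + 1)) / n) := by gcongr
    _ = ε / 2 := by field_simp
    _ < ε := by linarith

variable {E : Type*} [NormedAddCommGroup E] [NormedSpace ℂ E] {g : ℂ → E →L[ℂ] E} {a : E →L[ℂ] E}

/-- Dissipativity of i·s·a. For small t > 0, x + t b is g(its)x up to o(t), so ‖x‖ ≤ (1-t)‖x‖ + t‖x
+ b‖ + o(t); cancel and divide by t. -/
theorem norm_le_norm_add_I_smul_generator (h0 : g 0 = 1) (hd : HasDerivAt g a 0)
    (hiso : ∀ (t : ℝ) x, ‖g (t * Complex.I) x‖ = ‖x‖) (s : ℝ) (x : E) :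
    ‖x‖ ≤ ‖x + (s * Complex.I) • a x‖ := by
  have ho := hd.isLittleO
  simp only [h0, sub_zero] at ho
  set b : E := (s * Complex.I) • a x with hb
  refine le_of_forall_pos_le_add fun ε hε => ?_
  set δ : ℝ := ε / ((|s| + 1) * (‖x‖ + 1)) with hδ
  have hδ0 : 0 < δ := by positivity
  have ht : Tendsto (fun t : ℝ => (t : ℂ) * (s * Complex.I)) (𝓝[>] 0) (𝓝 0) := by
    have : Continuous (fun t : ℝ => (t : ℂ) * (s * Complex.I)) := by fun_prop
    have h := this.tendsto 0
    simp only [Complex.ofReal_zero, zero_mul] at h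
    exact h.mono_left nhdsWithin_le_nhds
  have hev := (ho.def hδ0)
  have h1 : ∀ᶠ t : ℝ in 𝓝[>] 0, t < 1 := nhdsWithin_le_nhds (eventually_lt_nhds one_pos)
  obtain ⟨t, hts, ht1, ht0⟩ := ((ht.eventually hev).and (h1.and self_mem_nhdsWithin)).exists
  replace ht0 : 0 < t := ht0
  have hnorm : ‖(t : ℂ) * (s * Complex.I)‖ = t * |s| := by
    simp [abs_of_pos ht0]
  rw [hnorm] at hts
  have hr : ‖g (t * (s * Complex.I)) x - x - (t : ℂ) • b‖ ≤ t * ε := by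
    have e : g (t * (s * Complex.I)) x - x - (t : ℂ) • b
        = (g (t * (s * Complex.I)) - 1 - ((t : ℂ) * (s * Complex.I)) • a) x := by
      simp [hb, smul_smul]
    rw [e]
    refine (ContinuousLinearMap.le_opNorm _ _).trans ?_
    calc _ ≤ δ * (t * |s|) * ‖x‖ := by gcongr
      _ ≤ δ * (t * (|s| + 1)) * (‖x‖ + 1) := by gcongr <;> linarith
      _ = t * ε := by rw [hδ]; field_simp
  have hx : ‖x‖ ≤ (1 - t) * ‖x‖ + t * ‖x + b‖ + t * ε := by
    calc ‖x‖ = ‖g (t * (s * Complex.I)) x‖ := by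
          rw [← hiso (t * s) x]; congr 3; push_cast; ring
      _ = ‖((1 - t : ℝ) : ℂ) • x + (t : ℂ) • (x + b) + (g (t * (s * Complex.I)) x - x - (t : ℂ) • b)‖ := by
          congr 1; push_cast; module
      _ ≤ ‖((1 - t : ℝ) : ℂ) • x‖ + ‖(t : ℂ) • (x + b)‖ + t * ε :=
          (norm_add_le _ _).trans (add_le_add (norm_add_le _ _) hr)
      _ = _ := by
          rw [norm_smul, norm_smul, Complex.norm_real, Complex.norm_real, Real.norm_of_nonneg ht0.le,
            Real.norm_of_nonneg (by linarith)]
  have : t * ‖x‖ ≤ t * (‖x + b‖ + ε) := by linarith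
  exact le_of_mul_le_mul_left this ht0

theorem norm_mul_norm_le_norm_generator_sub (h0 : g 0 = 1) (hd : HasDerivAt g a 0)
    (hiso : ∀ (t : ℝ) x, ‖g (t * Complex.I) x‖ = ‖x‖) {r : ℂ} (hr : r.re = 0) (x : E) :
    ‖r‖ * ‖x‖ ≤ ‖a x - r • x‖ := by
  have hrI : r = r.im * Complex.I := by
    apply Complex.ext <;> simp [hr]
  rcases eq_or_ne r.im 0 with him | him
  · have : r = 0 := by rw [hrI, him]; simp
    simp [this]
  · have h := norm_le_norm_add_I_smul_generator h0 hd hiso (r.im)⁻¹ x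
    have e : a x - r • x = (-r) • (x + (((r.im)⁻¹ : ℝ) * Complex.I) • a x) := by
      have h1 : (-r) * (((r.im)⁻¹ : ℝ) * Complex.I) = 1 := by
        have : (r.im : ℂ) ≠ 0 := by exact_mod_cast him
        nth_rewrite 1 [hrI]
        push_cast
        field_simp
        simp
      rw [smul_add, smul_smul, h1]; module
    rw [e, norm_smul, norm_neg]
    gcongr

/-- Split p into linear factors: each a - r expands norms by at least |r|, the modulus of X - r at
0. -/
theorem norm_eval_zero_mul_norm_le_norm_aeval_generator (h0 : g 0 = 1) (hd : HasDerivAt g a 0)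
    (hiso : ∀ (t : ℝ) x, ‖g (t * Complex.I) x‖ = ‖x‖) (p : ℂ[X])
    (hp : ∀ r ∈ p.roots, r.re = 0) (x : E) :
    ‖p.eval 0‖ * ‖x‖ ≤ ‖aeval a p x‖ := by
  have hprod : ∀ s : Multiset ℂ, (∀ r ∈ s, r.re = 0) → ∀ x : E,
      ‖((s.map fun r => X - C r).prod : ℂ[X]).eval 0‖ * ‖x‖
        ≤ ‖aeval a ((s.map fun r => X - C r).prod : ℂ[X]) x‖ := by
    intro s
    induction s using Multiset.induction with
    | empty => intro _ x; simp
    | cons r s ih =>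
      intro hs x
      have h1 := ih (fun q hq => hs q (Multiset.mem_cons_of_mem hq)) x
      have h2 := norm_mul_norm_le_norm_generator_sub h0 hd hiso (hs r (Multiset.mem_cons_self r s))
        (aeval a ((s.map fun r => X - C r).prod : ℂ[X]) x)
      simp only [Multiset.map_cons, Multiset.prod_cons, eval_mul, eval_sub, eval_X, eval_C, map_mul,
        map_sub, aeval_X, aeval_C, zero_sub, norm_mul, norm_neg]
      calc _ = ‖r‖ * (‖((s.map fun r => X - C r).prod : ℂ[X]).eval 0‖ * ‖x‖) := by ring
        _ ≤ _ := by gcongr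
        _ ≤ _ := h2
        _ = _ := by simp [Algebra.algebraMap_eq_smul_one]
  have hsplit := (IsAlgClosed.splits p).eq_prod_roots
  have h := hprod p.roots hp x
  rw [hsplit]
  rw [eval_mul, eval_C, norm_mul, map_mul, aeval_C, mul_assoc]
  calc _ ≤ _ := mul_le_mul_of_nonneg_left h (norm_nonneg _)
    _ = _ := by
      rw [← norm_smul]; simp [Algebra.algebraMap_eq_smul_one]

/-- An operator form of `1 ≤ cosh`: if `g` is a one-parameter group of operators whose
restriction to the imaginary axis is isometric, then `‖x‖ ≤ ‖(g 1 x + g (-1) x) / 2‖`. -/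
theorem two_mul_norm_le_norm_add_of_isometric_group (h0 : g 0 = 1)
    (hadd : ∀ z w, g (z + w) = g z * g w) (hd : HasDerivAt g a 0)
    (hiso : ∀ (t : ℝ) x, ‖g (t * Complex.I) x‖ = ‖x‖) (x : E) :
    2 * ‖x‖ ≤ ‖g 1 x + g (-1) x‖ := by
  have hlim : ∀ z : ℂ, Tendsto (fun n : ℕ => ((1 + (z / n) • a) ^ n) x) atTop (𝓝 (g z x)) := fun z =>
    ((ContinuousLinearMap.apply ℂ E x).continuous.tendsto _).comp
      (tendsto_one_add_smul_pow_of_hasDerivAt ContinuousLinearMap.norm_id_le h0 hadd hd z)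
  refine ge_of_tendsto ((hlim 1).add (hlim (-1))).norm ?_
  filter_upwards [eventually_gt_atTop 0] with n hn
  set p : ℂ[X] := (1 + C (1 / (n : ℂ)) * X) ^ n + (1 + C (-1 / (n : ℂ)) * X) ^ n with hp
  have hn0 : (n : ℂ) ≠ 0 := by exact_mod_cast hn.ne'
  have hroots : ∀ r ∈ p.roots, r.re = 0 := by
    intro r hr
    have hr0 : p.eval r = 0 := (mem_roots'.1 hr).2
    simp only [hp, eval_add, eval_pow, eval_one, eval_mul, eval_C, eval_X] at hr0
    have h1 : ‖1 + 1 / (n : ℂ) * r‖ ^ n = ‖1 + -1 / (n : ℂ) * r‖ ^ n := by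
      rw [← norm_pow, ← norm_pow, eq_neg_of_add_eq_zero_left hr0, norm_neg]
    -- A root is equidistant from n and -n, hence imaginary.
    have h2 := (pow_left_inj₀ (norm_nonneg _) (norm_nonneg _) hn.ne').1 h1
    have h3 : ‖(n : ℂ) + r‖ = ‖(n : ℂ) - r‖ := by
      have e1 : (n : ℂ) + r = n * (1 + 1 / (n : ℂ) * r) := by field_simp
      have e2 : (n : ℂ) - r = n * (1 + -1 / (n : ℂ) * r) := by field_simp; ring
      rw [e1, e2, norm_mul, norm_mul, h2]
    have h4 : Complex.normSq ((n : ℂ) + r) = Complex.normSq ((n : ℂ) - r) := by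
      rw [Complex.normSq_eq_norm_sq, Complex.normSq_eq_norm_sq, h3]
    simp only [Complex.normSq_apply, Complex.add_re, Complex.sub_re, Complex.add_im, Complex.sub_im,
      Complex.natCast_re, Complex.natCast_im] at h4
    have : (n : ℝ) * r.re = 0 := by linarith
    exact (mul_eq_zero.1 this).resolve_left (by exact_mod_cast hn.ne')
  have h := norm_eval_zero_mul_norm_le_norm_aeval_generator h0 hd hiso p hroots x
  have e0 : ‖p.eval 0‖ = 2 := by simp [hp]; norm_num
  rw [e0] at h
  refine h.trans_eq ?_
  simp [hp, Algebra.algebraMap_eq_smul_one]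

end OneParameterGroup

/-! ### The ideal as a normed space, and the arithmetic-geometric mean inequality -/

noncomputable section UnitaryInvariance

variable {H : Type*} [NormedAddCommGroup H] [InnerProductSpace ℂ H] [CompleteSpace H]

namespace UnitarilyInvariantNorm

/-- The ideal of a unitarily invariant norm, as a type that carries this norm instead of the
operator norm. -/
def Space (N : UnitarilyInvariantNorm H) : Type _ := N.ideal

variable (N : UnitarilyInvariantNorm H)

instance : AddCommGroup N.Space := inferInstanceAs (AddCommGroup N.ideal)
instance : Module ℂ N.Space := inferInstanceAs (Module ℂ N.ideal)
instance : Norm N.Space := ⟨N.norm⟩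

protected theorem norm_zero : N.norm 0 = 0 := by
  simpa using N.norm_smul 0 0

protected theorem norm_nonneg (X : N.ideal) : 0 ≤ N.norm X := by
  have h := N.norm_add_le X ((-1 : ℂ) • X)
  have e : X + (-1 : ℂ) • X = 0 := Subtype.ext (by simp)
  rw [e, N.norm_zero, N.norm_smul] at h
  simp only [norm_neg, norm_one, one_mul] at h
  linarith

theorem spaceCore : NormedSpace.Core ℂ N.Space where
  norm_nonneg := N.norm_nonneg
  norm_smul := N.norm_smul
  norm_triangle := N.norm_add_le
  norm_eq_zero_iff X := ⟨N.eq_zero_of_norm_eq_zero X, fun h => by rw [h]; exact N.norm_zero⟩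

instance : NormedAddCommGroup N.Space := NormedAddCommGroup.ofCore N.spaceCore
instance : NormedSpace ℂ N.Space := NormedSpace.ofCore N.spaceCore

/-- The operator underlying an element of the ideal. -/
def toOp : N.Space →ₗ[ℂ] H →L[ℂ] H := N.ideal.subtype

variable {N}

theorem toOp_injective : Function.Injective N.toOp := Subtype.val_injective

variable (N)

/-- `X ↦ S X T` on the ideal, as a map that is linear in `X`. -/
def mulMul (S T : H →L[ℂ] H) : N.Space →ₗ[ℂ] N.Space where
  toFun X := ⟨S * N.toOp X * T, N.mul_mem_right T (N.mul_mem_left S X.2)⟩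
  map_add' X Y := toOp_injective (by
    change S * N.toOp (X + Y) * T = S * N.toOp X * T + S * N.toOp Y * T
    rw [map_add, mul_add, add_mul])
  map_smul' c X := toOp_injective (by
    change S * N.toOp (c • X) * T = c • (S * N.toOp X * T)
    rw [map_smul, mul_smul_comm, smul_mul_assoc])

theorem toOp_mulMul (S T : H →L[ℂ] H) (X : N.Space) :
    N.toOp (N.mulMul S T X) = S * N.toOp X * T := rfl

theorem norm_mulMul_unitary {U V : H →L[ℂ] H} (hU : U ∈ unitary (H →L[ℂ] H))
    (hV : V ∈ unitary (H →L[ℂ] H)) (X : N.Space) : ‖N.mulMul U V X‖ = ‖X‖ :=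
  N.norm_unitary_mul_mul U hU V hV X

/-- Each operator is a combination of four unitaries with coefficients at most half its norm; the 16
terms give 16/4 = 4. This crude constant suffices, as only continuity and boundedness are drawn from
it. -/
theorem norm_mulMul_le (S T : H →L[ℂ] H) (X : N.Space) :
    ‖N.mulMul S T X‖ ≤ 4 * ‖S‖ * ‖T‖ * ‖X‖ := by
  obtain ⟨u, c, hS, hc⟩ := CStarAlgebra.exists_sum_four_unitary S
  obtain ⟨v, d, hT, hd⟩ := CStarAlgebra.exists_sum_four_unitary T
  have e : N.mulMul S T X = ∑ i, ∑ j, (c i * d j) • N.mulMul (u i) (v j) X := by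
    apply toOp_injective
    simp only [map_sum, map_smul, toOp_mulMul]
    nth_rewrite 1 [hS, hT]
    simp only [Finset.sum_mul, Finset.mul_sum, smul_mul_assoc, mul_smul_comm, Finset.smul_sum, smul_smul]
    rw [Finset.sum_comm]
    simp only [mul_comm (c _)]
  rw [e]
  calc _ ≤ ∑ i : Fin 4, ∑ j : Fin 4, (‖S‖ / 2) * (‖T‖ / 2) * ‖X‖ := by
        refine (norm_sum_le _ _).trans (Finset.sum_le_sum fun i _ => (norm_sum_le _ _).trans
          (Finset.sum_le_sum fun j _ => ?_))
        rw [_root_.norm_smul, norm_mul, N.norm_mulMul_unitary (u i).2 (v j).2]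
        gcongr
        · exact hc i
        · exact hd j
    _ = _ := by simp; ring

/-- Left multiplication on the ideal. -/
def mulLeft : (H →L[ℂ] H) →L[ℂ] N.Space →L[ℂ] N.Space :=
  LinearMap.mkContinuous₂
    (LinearMap.mk₂ ℂ (fun S X => N.mulMul S 1 X)
      (fun S T X => toOp_injective (by simp [toOp_mulMul, add_mul]))
      (fun c S X => toOp_injective (by simp [toOp_mulMul]))
      (fun S X Y => map_add _ _ _) (fun c S X => map_smul _ _ _))
    4 (fun S X => by
      refine (N.norm_mulMul_le S 1 X).trans ?_
      have : ‖(1 : H →L[ℂ] H)‖ ≤ 1 := ContinuousLinearMap.norm_id_le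
      nlinarith [mul_nonneg (_root_.norm_nonneg S) (_root_.norm_nonneg X)])

/-- Right multiplication on the ideal. -/
def mulRight : (H →L[ℂ] H) →L[ℂ] N.Space →L[ℂ] N.Space :=
  LinearMap.mkContinuous₂
    (LinearMap.mk₂ ℂ (fun T X => N.mulMul 1 T X)
      (fun S T X => toOp_injective (by simp [toOp_mulMul, mul_add]))
      (fun c S X => toOp_injective (by simp [toOp_mulMul]))
      (fun S X Y => map_add _ _ _) (fun c S X => map_smul _ _ _))
    4 (fun S X => by
      refine (N.norm_mulMul_le 1 S X).trans ?_
      have : ‖(1 : H →L[ℂ] H)‖ ≤ 1 := ContinuousLinearMap.norm_id_le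
      nlinarith [mul_nonneg (_root_.norm_nonneg S) (_root_.norm_nonneg X)])

theorem toOp_mulLeft (S : H →L[ℂ] H) (X : N.Space) : N.toOp (N.mulLeft S X) = S * N.toOp X :=
  mul_one _

theorem toOp_mulRight (T : H →L[ℂ] H) (X : N.Space) : N.toOp (N.mulRight T X) = N.toOp X * T := by
  change 1 * N.toOp X * T = _
  rw [one_mul]

open NormedSpace in
/-- The one-parameter group `X ↦ exp (z G) X exp (-z K)` on the ideal. -/
def expConj (G K : H →L[ℂ] H) (z : ℂ) : N.Space →L[ℂ] N.Space :=
  N.mulLeft (exp (z • G)) * N.mulRight (exp (z • -K))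

open NormedSpace in
theorem toOp_expConj (G K : H →L[ℂ] H) (z : ℂ) (X : N.Space) :
    N.toOp (N.expConj G K z X) = exp (z • G) * N.toOp X * exp (z • -K) := by
  rw [expConj, mul_apply_eq_comp, toOp_mulLeft, toOp_mulRight, mul_assoc]

open NormedSpace in
theorem exp_add_smul_self (G : H →L[ℂ] H) (z w : ℂ) :
    exp ((z + w) • G) = exp (z • G) * exp (w • G) := by
  let +nondep : NormedAlgebra ℚ (H →L[ℂ] H) := .restrictScalars ℚ ℂ _
  rw [add_smul]
  exact exp_add_of_commute ((Commute.refl G).smul_left z |>.smul_right w)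

theorem expConj_zero (G K : H →L[ℂ] H) : N.expConj G K 0 = 1 := by
  ext X : 1
  apply toOp_injective
  simp [toOp_expConj]

theorem expConj_add (G K : H →L[ℂ] H) (z w : ℂ) :
    N.expConj G K (z + w) = N.expConj G K z * N.expConj G K w := by
  ext X : 1
  apply toOp_injective
  rw [mul_apply_eq_comp]
  simp only [toOp_expConj]
  rw [exp_add_smul_self, add_comm z w, exp_add_smul_self (-K)]
  simp only [mul_assoc]

theorem hasDerivAt_expConj (G K : H →L[ℂ] H) :
    HasDerivAt (N.expConj G K) (N.mulLeft G - N.mulRight K) 0 := by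
  have h1 := N.mulLeft.hasFDerivAt.comp_hasDerivAt (0 : ℂ) (hasDerivAt_exp_smul_const G (0 : ℂ))
  have h2 := N.mulRight.hasFDerivAt.comp_hasDerivAt (0 : ℂ) (hasDerivAt_exp_smul_const (-K) (0 : ℂ))
  have h := h1.mul h2
  have hL : N.mulLeft 1 = 1 := by ext X : 1; exact toOp_injective (by simp [toOp_mulLeft])
  have hR : N.mulRight 1 = 1 := by ext X : 1; exact toOp_injective (by simp [toOp_mulRight])
  refine h.congr_deriv ?_
  simp only [Function.comp, zero_smul, NormedSpace.exp_zero, one_mul, hL, hR, mul_one, map_neg,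
    sub_eq_add_neg]

open NormedSpace in
theorem exp_ofReal_mul_I_smul_mem_unitary {G : H →L[ℂ] H} (hG : IsSelfAdjoint G) (t : ℝ) :
    exp (((t : ℂ) * Complex.I) • G) ∈ unitary (H →L[ℂ] H) := by
  let +nondep : NormedAlgebra ℚ (H →L[ℂ] H) := .restrictScalars ℚ ℂ _
  refine exp_mem_unitary_of_mem_skewAdjoint (skewAdjoint.mem_iff.2 ?_)
  rw [star_smul, hG.star_eq, ← neg_smul]
  simp

theorem norm_expConj_ofReal_mul_I {G K : H →L[ℂ] H} (hG : IsSelfAdjoint G) (hK : IsSelfAdjoint K)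
    (t : ℝ) (X : N.Space) : ‖N.expConj G K (t * Complex.I) X‖ = ‖X‖ := by
  rw [← N.norm_mulMul_unitary (exp_ofReal_mul_I_smul_mem_unitary hG t)
    (exp_ofReal_mul_I_smul_mem_unitary hK.neg t) X]
  exact congrArg _ (toOp_injective (by rw [toOp_expConj, toOp_mulMul]))

open NormedSpace in
-- Take G = log C, K = log D and apply the group to CYD: time 1 gives C²Y, time -1 gives YD².
theorem two_mul_norm_mulMul_le_of_isStrictlyPositive {C D : H →L[ℂ] H} (hC : IsStrictlyPositive C)
    (hD : IsStrictlyPositive D) (Y : N.Space) :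
    2 * ‖N.mulMul C D Y‖ ≤ ‖N.mulMul (C * C) 1 Y + N.mulMul 1 (D * D) Y‖ := by
  have hG : IsSelfAdjoint (CFC.log C) := .log
  have hK : IsSelfAdjoint (CFC.log D) := .log
  have h := two_mul_norm_le_norm_add_of_isometric_group (N.expConj_zero (CFC.log C) (CFC.log D))
    (N.expConj_add _ _) (N.hasDerivAt_expConj _ _) (N.norm_expConj_ofReal_mul_I hG hK)
    (N.mulMul C D Y)
  refine h.trans_eq (congrArg _ (toOp_injective ?_))
  have eC := CFC.exp_log C hC
  have eD := CFC.exp_log D hD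
  have hneg : ∀ {C : H →L[ℂ] H}, IsStrictlyPositive C →
      exp (-CFC.log C) * C = 1 ∧ C * exp (-CFC.log C) = 1 := by
    intro C hC
    have h1 := exp_add_smul_self (CFC.log C) (-1) 1
    have h2 := exp_add_smul_self (CFC.log C) 1 (-1)
    simp only [neg_add_cancel, add_neg_cancel, zero_smul, exp_zero, neg_smul, one_smul,
      CFC.exp_log C hC] at h1 h2
    exact ⟨h1.symm, h2.symm⟩
  simp only [map_add, toOp_expConj, toOp_mulMul, one_smul, neg_smul, neg_neg, eC, eD, one_mul,
    mul_one]
  have e1 : C * (C * N.toOp Y * D) * exp (-CFC.log D)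
      = C * C * N.toOp Y * (D * exp (-CFC.log D)) := by simp only [mul_assoc]
  have e2 : exp (-CFC.log C) * (C * N.toOp Y * D) * D
      = (exp (-CFC.log C) * C) * N.toOp Y * (D * D) := by simp only [mul_assoc]
  rw [e1, e2, (hneg hD).2, (hneg hC).1, mul_one, one_mul]

/-- The arithmetic-geometric mean inequality `2 |||C Y D||| ≤ |||C² Y + Y D²|||` for positive
operators `C`, `D`. -/
theorem two_mul_norm_mulMul_le {C D : H →L[ℂ] H} (hC : 0 ≤ C) (hD : 0 ≤ D) (Y : N.Space) :
    2 * ‖N.mulMul C D Y‖ ≤ ‖N.mulMul (C * C) 1 Y + N.mulMul 1 (D * D) Y‖ := by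
  -- Shift C and D by ε > 0 to make them invertible, then let ε → 0.
  have hpos : ∀ {C : H →L[ℂ] H}, 0 ≤ C → ∀ ε : ℝ, 0 < ε →
      IsStrictlyPositive (C + algebraMap ℝ (H →L[ℂ] H) ε) := by
    intro C hC ε hε
    exact IsStrictlyPositive.nonneg_add hC ((isStrictlyPositive_algebraMap hε))
  have hcont : ∀ f : ℝ → N.Space, Continuous f → Filter.Tendsto (fun ε => ‖f ε‖)
      (nhdsWithin 0 (Set.Ioi 0)) (nhds ‖f 0‖) := fun f hf =>
    (hf.norm.tendsto 0).mono_left nhdsWithin_le_nhds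
  have hL := hcont (fun ε => N.mulLeft (C + algebraMap ℝ (H →L[ℂ] H) ε)
    (N.mulRight (D + algebraMap ℝ (H →L[ℂ] H) ε) Y)) (by fun_prop)
  have hR := hcont (fun ε =>
    N.mulLeft ((C + algebraMap ℝ (H →L[ℂ] H) ε) * (C + algebraMap ℝ (H →L[ℂ] H) ε)) Y
    + N.mulRight ((D + algebraMap ℝ (H →L[ℂ] H) ε) * (D + algebraMap ℝ (H →L[ℂ] H) ε)) Y)
    (by fun_prop)
  have hlr : ∀ C D : H →L[ℂ] H, N.mulLeft C (N.mulRight D Y) = N.mulMul C D Y := fun C D =>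
    toOp_injective (by rw [toOp_mulLeft, toOp_mulRight, toOp_mulMul, mul_assoc])
  simp only [hlr, map_zero, add_zero] at hL hR
  refine le_of_tendsto_of_tendsto (hL.const_mul 2) hR ?_
  filter_upwards [self_mem_nhdsWithin] with ε hε
  exact N.two_mul_norm_mulMul_le_of_isStrictlyPositive (hpos hC ε hε) (hpos hD ε hε) Y

end UnitarilyInvariantNorm

end UnitaryInvariance

/-! ### Convexity from midpoints, Hermite-Hadamard and El Farissi -/

section ConvexFunctions

open Set MeasureTheory

/-- A midpoint convex function that is bounded above on a segment is convex there, the end points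
included. -/
theorem convexOn_Icc_of_midpoint_of_bounded {f : ℝ → ℝ} {a b M : ℝ}
    (hmid : ∀ x ∈ Icc a b, ∀ y ∈ Icc a b, f ((x + y) / 2) ≤ (f x + f y) / 2)
    (hM : ∀ x ∈ Icc a b, f x ≤ M) : ConvexOn ℝ (Icc a b) f := by
  refine ⟨convex_Icc a b, fun x hx y hy u v hu hv huv => ?_⟩
  have hmem : ∀ t ∈ Icc (0 : ℝ) 1, (1 - t) * x + t * y ∈ Icc a b := fun t ht =>
    (convex_Icc a b) hx hy (sub_nonneg.2 ht.2) ht.1 (by ring)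
  set g : ℝ → ℝ := fun t => f ((1 - t) * x + t * y) - (1 - t) * f x - t * f y with hg
  have hgmid : ∀ s ∈ Icc (0 : ℝ) 1, ∀ t ∈ Icc (0 : ℝ) 1, g ((s + t) / 2) ≤ (g s + g t) / 2 := by
    intro s hs t ht
    have h := hmid _ (hmem s hs) _ (hmem t ht)
    have e : ((1 - s) * x + s * y + ((1 - t) * x + t * y)) / 2
        = (1 - (s + t) / 2) * x + (s + t) / 2 * y := by ring
    rw [e] at h
    simp only [hg]
    linarith
  have hg0 : g 0 = 0 := by simp [hg]
  have hg1 : g 1 = 0 := by simp [hg]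
  set K := |M| + |f x| + |f y| with hK
  have hK0 : 0 ≤ K := by positivity
  -- With the chord subtracted, g vanishes at 0 and 1, so g(t) is at most half of g(2t) or g(2t-1):
  -- every upper bound can be halved.
  have hbound : ∀ n : ℕ, ∀ t ∈ Icc (0 : ℝ) 1, g t ≤ K * (1 / 2) ^ n := by
    intro n
    induction n with
    | zero =>
      intro t ht
      have h1 := (hM _ (hmem t ht)).trans (le_abs_self M)
      have h2 : -(1 - t) * f x ≤ |f x| := by
        have := neg_abs_le (f x)
        nlinarith [ht.1, ht.2, abs_nonneg (f x)]
      have h3 : -t * f y ≤ |f y| := by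
        have := neg_abs_le (f y)
        nlinarith [ht.1, ht.2, abs_nonneg (f y)]
      simp only [hg, pow_zero, mul_one]
      linarith
    | succ n ih =>
      intro t ht
      rw [pow_succ]
      rcases le_total t (1 / 2) with h | h
      · have hs : 2 * t ∈ Icc (0 : ℝ) 1 := ⟨by linarith [ht.1], by linarith⟩
        have h1 := hgmid 0 (by simp) _ hs
        have h2 := ih _ hs
        rw [hg0, show (0 + 2 * t) / 2 = t by ring] at h1
        linarith
      · have hs : 2 * t - 1 ∈ Icc (0 : ℝ) 1 := ⟨by linarith, by linarith [ht.2]⟩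
        have h1 := hgmid 1 (by simp) _ hs
        have h2 := ih _ hs
        rw [hg1, show (1 + (2 * t - 1)) / 2 = t by ring] at h1
        linarith
  have hv1 : v ∈ Icc (0 : ℝ) 1 := ⟨hv, by linarith⟩
  have hlim : Filter.Tendsto (fun n : ℕ => K * (1 / 2 : ℝ) ^ n) Filter.atTop (nhds 0) := by
    simpa using (tendsto_pow_atTop_nhds_zero_of_lt_one (by norm_num : (0 : ℝ) ≤ 1 / 2)
      (by norm_num)).const_mul K
  have h := ge_of_tendsto' hlim fun n => hbound n v hv1
  have hu' : u = 1 - v := by linarith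
  simp only [hg] at h
  simp only [smul_eq_mul, hu']
  linarith

theorem ConvexOn.add_reflect_le {f : ℝ → ℝ} {a b x : ℝ} (hf : ConvexOn ℝ (Icc a b) f)
    (hx : x ∈ Icc a b) : f x + f (a + b - x) ≤ f a + f b := by
  have hab : a ≤ b := hx.1.trans hx.2
  rcases hab.eq_or_lt with rfl | hlt
  · have : x = a := le_antisymm hx.2 hx.1
    simp [this]
  · have hd : 0 < b - a := sub_pos.2 hlt
    have hu : 0 ≤ (b - x) / (b - a) := div_nonneg (by linarith [hx.2]) hd.le
    have hv : 0 ≤ (x - a) / (b - a) := div_nonneg (by linarith [hx.1]) hd.le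
    have huv : (b - x) / (b - a) + (x - a) / (b - a) = 1 := by field_simp; ring
    have h1 := hf.2 (left_mem_Icc.2 hab) (right_mem_Icc.2 hab) hu hv huv
    have h2 := hf.2 (left_mem_Icc.2 hab) (right_mem_Icc.2 hab) hv hu (by linarith)
    simp only [smul_eq_mul] at h1 h2
    have e1 : (b - x) / (b - a) * a + (x - a) / (b - a) * b = x := by field_simp; ring
    have e2 : (x - a) / (b - a) * a + (b - x) / (b - a) * b = a + b - x := by field_simp; ring
    rw [e1] at h1
    rw [e2] at h2
    have e3 : (b - x) / (b - a) = 1 - (x - a) / (b - a) := by linarith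
    rw [e3] at h1 h2
    linarith

theorem ConvexOn.two_mul_le_add_reflect {f : ℝ → ℝ} {a b x : ℝ} (hf : ConvexOn ℝ (Icc a b) f)
    (hx : x ∈ Icc a b) : 2 * f ((a + b) / 2) ≤ f x + f (a + b - x) := by
  have h := hf.2 hx (y := a + b - x) ⟨by linarith [hx.2], by linarith [hx.1]⟩
    (by norm_num : (0 : ℝ) ≤ 1 / 2) (by norm_num : (0 : ℝ) ≤ 1 / 2) (by norm_num)
  simp only [smul_eq_mul] at h
  rw [show 1 / 2 * x + 1 / 2 * (a + b - x) = (a + b) / 2 by ring] at h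
  linarith

/-- Continuity in the interior gives measurability. The end values bound f above; reflection in the
midpoint turns this into a bound below. -/
theorem ConvexOn.integrableOn_Icc {f : ℝ → ℝ} {a b : ℝ} (hf : ConvexOn ℝ (Icc a b) f) :
    IntegrableOn f (Icc a b) := by
  rw [integrableOn_Icc_iff_integrableOn_Ioo]
  have hcont : ContinuousOn f (Ioo a b) := by
    have := hf.continuousOn_interior
    rwa [interior_Icc] at this
  refine IntegrableOn.of_bound (by simp) (hcont.aestronglyMeasurable measurableSet_Ioo)
    (max |f a| |f b| + 2 * |f ((a + b) / 2)| + max |f a| |f b|) ?_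
  have hle : ∀ x ∈ Icc a b, f x ≤ max |f a| |f b| := fun x hx =>
    (hf.le_max_of_mem_Icc (left_mem_Icc.2 (hx.1.trans hx.2)) (right_mem_Icc.2 (hx.1.trans hx.2))
      hx).trans (max_le_max (le_abs_self _) (le_abs_self _))
  refine (ae_restrict_iff' measurableSet_Ioo).2 (Filter.Eventually.of_forall fun x hx => ?_)
  have hx' := Ioo_subset_Icc_self hx
  have h1 := hle x hx'
  have h2 := hle (a + b - x) ⟨by linarith [hx'.2], by linarith [hx'.1]⟩
  have h3 := hf.two_mul_le_add_reflect hx'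
  have h4 := neg_abs_le (f ((a + b) / 2))
  have h5 : 0 ≤ max |f a| |f b| := (abs_nonneg _).trans (le_max_left _ _)
  have h6 := abs_nonneg (f ((a + b) / 2))
  rw [Real.norm_eq_abs, abs_le]
  constructor <;> linarith

/-- The Hermite-Hadamard inequality. -/
theorem ConvexOn.hermite_hadamard {f : ℝ → ℝ} {a b : ℝ} (hab : a ≤ b)
    (hf : ConvexOn ℝ (Icc a b) f) :
    (b - a) * f ((a + b) / 2) ≤ ∫ x in a..b, f x ∧
      ∫ x in a..b, f x ≤ (b - a) * ((f a + f b) / 2) := by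
  have hint : IntervalIntegrable f volume a b :=
    (intervalIntegrable_iff_integrableOn_Icc_of_le hab).2 hf.integrableOn_Icc
  have hint' : IntervalIntegrable (fun x => f (a + b - x)) volume a b := by
    have := (hint.comp_sub_left (a + b)).symm
    simpa using this
  have e : ∫ x in a..b, f (a + b - x) = ∫ x in a..b, f x := by
    rw [intervalIntegral.integral_comp_sub_left]; simp
  have hsum : ∫ x in a..b, (f x + f (a + b - x)) = 2 * ∫ x in a..b, f x := by
    rw [intervalIntegral.integral_add hint hint', e]; ring
  have h1 := intervalIntegral.integral_mono_on hab intervalIntegrable_const (hint.add hint')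
    fun x hx => hf.two_mul_le_add_reflect hx
  have h2 := intervalIntegral.integral_mono_on hab (hint.add hint') intervalIntegrable_const
    fun x hx => hf.add_reflect_le hx
  rw [intervalIntegral.integral_const, hsum, smul_eq_mul] at h1
  rw [intervalIntegral.integral_const, hsum, smul_eq_mul] at h2
  constructor <;> linarith

/-- The inner inequalities add Hermite-Hadamard on [0, lam] and [lam, 1]; the outer ones are
convexity at 1/2 and at lam. -/
theorem ConvexOn.farissi_zero_one {h : ℝ → ℝ} (hh : ConvexOn ℝ (Icc 0 1) h) {lam : ℝ}
    (hlam : lam ∈ Icc (0 : ℝ) 1) :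
    h (1 / 2) ≤ lam * h (lam / 2) + (1 - lam) * h ((1 + lam) / 2) ∧
    lam * h (lam / 2) + (1 - lam) * h ((1 + lam) / 2) ≤ ∫ x in (0 : ℝ)..1, h x ∧
    ∫ x in (0 : ℝ)..1, h x ≤ 1 / 2 * (h lam + lam * h 0 + (1 - lam) * h 1) ∧
    1 / 2 * (h lam + lam * h 0 + (1 - lam) * h 1) ≤ (h 0 + h 1) / 2 := by
  obtain ⟨h0, h1⟩ := hlam
  have hl := (hh.subset (Icc_subset_Icc_right h1) (convex_Icc 0 lam)).hermite_hadamard h0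
  have hr := (hh.subset (Icc_subset_Icc_left h0) (convex_Icc lam 1)).hermite_hadamard h1
  have hint : ∀ {a b : ℝ}, 0 ≤ a → a ≤ b → b ≤ 1 → IntervalIntegrable h volume a b :=
    fun ha hab hb => (intervalIntegrable_iff_integrableOn_Icc_of_le hab).2
      (hh.integrableOn_Icc.mono_set (Icc_subset_Icc ha hb))
  have hadd := intervalIntegral.integral_add_adjacent_intervals (hint le_rfl h0 h1) (hint h0 h1 le_rfl)
  rw [sub_zero, zero_add] at hl
  rw [add_comm lam 1] at hr
  have hlow := hh.2 (x := lam / 2) ⟨by linarith, by linarith⟩ (y := (1 + lam) / 2)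
    ⟨by linarith, by linarith⟩ h0 (sub_nonneg.2 h1) (by ring)
  have hup := hh.2 (x := 0) (by simp) (y := 1) (by simp) (sub_nonneg.2 h1) h0 (by ring)
  simp only [smul_eq_mul] at hlow hup
  rw [show lam * (lam / 2) + (1 - lam) * ((1 + lam) / 2) = 1 / 2 by ring] at hlow
  rw [show (1 - lam) * 0 + lam * 1 = lam by ring] at hup
  refine ⟨hlow, ?_, ?_, ?_⟩ <;> linarith [hl.1, hl.2, hr.1, hr.2]

theorem integralMean_eq_integral_lineMap (f : ℝ → ℝ) (a b : ℝ) :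
    integralMean f a b = ∫ u in (0 : ℝ)..1, f ((b - a) * u + a) := by
  unfold integralMean
  split_ifs with hab
  · simp [hab]
  · rw [intervalIntegral.integral_comp_mul_add f (sub_ne_zero.2 (Ne.symm hab))]
    simp

/-- El Farissi's refinement of the Hermite-Hadamard inequality. -/
theorem ConvexOn.farissi {f : ℝ → ℝ} {s : Set ℝ} (hf : ConvexOn ℝ s f) {a b : ℝ} (ha : a ∈ s)
    (hb : b ∈ s) {lam : ℝ} (hlam : lam ∈ Icc (0 : ℝ) 1) :
    f ((a + b) / 2) ≤ farissiLower f a b lam ∧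
    farissiLower f a b lam ≤ integralMean f a b ∧
    integralMean f a b ≤ farissiUpper f a b lam ∧
    farissiUpper f a b lam ≤ (f a + f b) / 2 := by
  -- Pulling back to [0,1] treats a < b, a = b and a > b at once.
  have hh : ConvexOn ℝ (Icc 0 1) fun u => f ((b - a) * u + a) := by
    refine ⟨convex_Icc 0 1, fun x hx y hy u v hu hv huv => ?_⟩
    have hmem : ∀ t ∈ Icc (0 : ℝ) 1, (b - a) * t + a ∈ s := fun t ht => by
      have := hf.1 ha hb (sub_nonneg.2 ht.2) ht.1 (by ring)
      simp only [smul_eq_mul] at this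
      convert this using 1
      ring
    have h := hf.2 (hmem x hx) (hmem y hy) hu hv huv
    convert h using 2
    simp only [smul_eq_mul]
    linear_combination (-a) * huv
  have h := hh.farissi_zero_one hlam
  rw [integralMean_eq_integral_lineMap, farissiLower, farissiUpper]
  convert h using 3 <;> ring_nf

end ConvexFunctions

/-! ### Convexity of the Heinz norm -/

noncomputable section HeinzNorm

variable {H : Type*} [NormedAddCommGroup H] [InnerProductSpace ℂ H] [CompleteSpace H]

/-- Nonnegative exponents keep the power functions continuous at 0, so A need not be invertible. -/
theorem CFC.rpow_mul_rpow_of_nonneg (A : H →L[ℂ] H) {x y : ℝ} (hx : 0 ≤ x)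
    (hy : 0 ≤ y) : A ^ x * A ^ y = A ^ (x + y) := by
  simp only [CFC.rpow_def]
  rw [← cfc_mul _ _ A (NNReal.continuous_rpow_const hx).continuousOn
    (NNReal.continuous_rpow_const hy).continuousOn]
  exact cfc_congr fun z _ => (NNReal.rpow_add_of_nonneg z hx hy).symm

theorem CFC.norm_rpow_le_one_add_norm {A : H →L[ℂ] H} {ν : ℝ} (hA : 0 ≤ A)
    (hν : ν ∈ Set.Icc (0 : ℝ) 1) : ‖A ^ ν‖ ≤ 1 + ‖A‖ := by
  rw [CFC.rpow_def, ← coe_nnnorm, ← coe_nnnorm, ← NNReal.coe_one, ← NNReal.coe_add,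
    NNReal.coe_le_coe]
  refine nnnorm_cfc_nnreal_le fun x hx => ?_
  have hxA : x ≤ ‖A‖₊ := by
    have h := apply_le_nnnorm_cfc_nnreal id A hx
    rwa [cfc_id NNReal A] at h
  rcases le_total x 1 with h | h
  · exact (NNReal.rpow_le_one h hν.1).trans (by simp)
  · calc x ^ ν ≤ x ^ (1 : ℝ) := NNReal.rpow_le_rpow_of_exponent_le h hν.2
      _ = x := NNReal.rpow_one x
      _ ≤ _ := hxA.trans (by simp)

variable (N : UnitarilyInvariantNorm H)

/-- `heinzOp A B X ν` as an element of the normed space on which `N` is the norm. -/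
def heinzElem (A B : H →L[ℂ] H) (X : N.Space) (ν : ℝ) : N.Space :=
  N.mulMul (A ^ ν) (B ^ (1 - ν)) X + N.mulMul (A ^ (1 - ν)) (B ^ ν) X

theorem heinzNorm_eq_norm_heinzElem (A B : H →L[ℂ] H) (X : N.ideal) (ν : ℝ) :
    heinzNorm N A B X ν = ‖heinzElem N A B X ν‖ := rfl

theorem norm_heinzElem_midpoint_le {A B : H →L[ℂ] H} (X : N.Space)
    {x y : ℝ} (hx : x ∈ Set.Icc (0 : ℝ) 1) (hy : y ∈ Set.Icc (0 : ℝ) 1) (hxy : x ≤ y) :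
    2 * ‖heinzElem N A B X ((x + y) / 2)‖ ≤ ‖heinzElem N A B X x + heinzElem N A B X y‖ := by
  have ht : 0 ≤ (y - x) / 2 := by linarith
  have hy' : 0 ≤ 1 - y := by linarith [hy.2]
  -- For Y = A^x X B^(1-y) + A^(1-y) X B^x, CYD is the Heinz element at the midpoint, and C²Y + YD²
  -- is the sum of those at x and y.
  have h := N.two_mul_norm_mulMul_le (C := A ^ ((y - x) / 2)) (D := B ^ ((y - x) / 2))
    CFC.rpow_nonneg CFC.rpow_nonneg
    (N.mulMul (A ^ x) (B ^ (1 - y)) X + N.mulMul (A ^ (1 - y)) (B ^ x) X)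
  have comp : ∀ (S T P Q : H →L[ℂ] H), N.mulMul S T (N.mulMul P Q X) = N.mulMul (S * P) (Q * T) X :=
    fun S T P Q => UnitarilyInvariantNorm.toOp_injective (by
      simp only [UnitarilyInvariantNorm.toOp_mulMul, mul_assoc])
  simp only [map_add, comp, one_mul, mul_one] at h
  have hyx : 0 ≤ y - x := sub_nonneg.2 hxy
  simp only [CFC.rpow_mul_rpow_of_nonneg _ ht ht, add_halves,
    CFC.rpow_mul_rpow_of_nonneg _ ht hx.1, CFC.rpow_mul_rpow_of_nonneg _ ht hy',
    CFC.rpow_mul_rpow_of_nonneg _ hx.1 ht, CFC.rpow_mul_rpow_of_nonneg _ hy' ht,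
    CFC.rpow_mul_rpow_of_nonneg _ hyx hx.1, CFC.rpow_mul_rpow_of_nonneg _ hyx hy',
    CFC.rpow_mul_rpow_of_nonneg _ hx.1 hyx, CFC.rpow_mul_rpow_of_nonneg _ hy' hyx] at h
  rw [show (y - x) / 2 + x = (x + y) / 2 by ring, show 1 - y + (y - x) / 2 = 1 - (x + y) / 2 by ring,
    show (y - x) / 2 + (1 - y) = 1 - (x + y) / 2 by ring, show x + (y - x) / 2 = (x + y) / 2 by ring,
    show y - x + x = y by ring, show y - x + (1 - y) = 1 - x by ring,
    show 1 - y + (y - x) = 1 - x by ring, show x + (y - x) = y by ring] at h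
  refine h.trans_eq (congrArg _ ?_)
  simp only [heinzElem]
  abel

theorem convexOn_heinzNorm {A B : H →L[ℂ] H} (hA : 0 ≤ A) (hB : 0 ≤ B) (X : N.ideal) :
    ConvexOn ℝ (Set.Icc 0 1) (heinzNorm N A B X) := by
  refine convexOn_Icc_of_midpoint_of_bounded
    (M := 4 * (1 + ‖A‖) * (1 + ‖B‖) * N.norm X + 4 * (1 + ‖A‖) * (1 + ‖B‖) * N.norm X) ?_ ?_
  · have key : ∀ x ∈ Set.Icc (0 : ℝ) 1, ∀ y ∈ Set.Icc (0 : ℝ) 1, x ≤ y →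
        heinzNorm N A B X ((x + y) / 2) ≤ (heinzNorm N A B X x + heinzNorm N A B X y) / 2 := by
      intro x hx y hy hxy
      have h1 := norm_heinzElem_midpoint_le N (A := A) (B := B) X hx hy hxy
      have h2 := norm_add_le (heinzElem N A B X x) (heinzElem N A B X y)
      simp only [heinzNorm_eq_norm_heinzElem]
      linarith
    intro x hx y hy
    rcases le_total x y with h | h
    · exact key x hx y hy h
    · rw [add_comm x, add_comm (heinzNorm N A B X x)]
      exact key y hy x hx h
  · intro ν hν
    have hν' : 1 - ν ∈ Set.Icc (0 : ℝ) 1 := ⟨by linarith [hν.2], by linarith [hν.1]⟩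
    have key : ∀ μ ∈ Set.Icc (0 : ℝ) 1, ∀ κ ∈ Set.Icc (0 : ℝ) 1,
        ‖N.mulMul (A ^ μ) (B ^ κ) X‖ ≤ 4 * (1 + ‖A‖) * (1 + ‖B‖) * N.norm X := by
      intro μ hμ κ hκ
      refine (N.norm_mulMul_le _ _ X).trans ?_
      have h1 := CFC.norm_rpow_le_one_add_norm hA hμ
      have h2 := CFC.norm_rpow_le_one_add_norm hB hκ
      have h3 := N.norm_nonneg X
      change 4 * _ * _ * N.norm X ≤ _
      gcongr
    rw [heinzNorm_eq_norm_heinzElem]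
    exact (norm_add_le _ _).trans (add_le_add (key _ hν _ hν') (key _ hν' _ hν))

end HeinzNorm

theorem theorem3p4 {H : Type*} [NormedAddCommGroup H] [InnerProductSpace ℂ H] [CompleteSpace H]
    (N : UnitarilyInvariantNorm H) (A B : H →L[ℂ] H) (hA : A.IsPositive) (hB : B.IsPositive)
    (X : N.ideal) (α β : ℝ) (hα : α ∈ Set.Icc (0 : ℝ) 1) (hβ : β ∈ Set.Icc (0 : ℝ) 1) :
    IntervalIntegrable (heinzNorm N A B X) MeasureTheory.volume α β ∧
    ∀ lam ∈ Set.Icc (0 : ℝ) 1,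
      heinzNorm N A B X ((α + β) / 2) ≤ farissiLower (heinzNorm N A B X) α β lam ∧
      farissiLower (heinzNorm N A B X) α β lam ≤ integralMean (heinzNorm N A B X) α β ∧
      integralMean (heinzNorm N A B X) α β ≤ farissiUpper (heinzNorm N A B X) α β lam ∧
      farissiUpper (heinzNorm N A B X) α β lam ≤
        (heinzNorm N A B X α + heinzNorm N A B X β) / 2 := by
  have hconv := convexOn_heinzNorm N ((ContinuousLinearMap.nonneg_iff_isPositive A).2 hA)
    ((ContinuousLinearMap.nonneg_iff_isPositive B).2 hB) X
  refine ⟨?_, fun lam hlam => hconv.farissi hα hβ hlam⟩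
  exact (hconv.integrableOn_Icc.mono_set (Set.uIcc_subset_Icc hα hβ)).intervalIntegrable
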